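/- Let $K,n\ge 1$ and $d>K$ be integers, let $\lambda_{W_2},\lambda_{W_1},\lambda_{H_1}>0$, and let $\mathbf{Y}=\mathbf{I}_K\otimes\mathbf{1}_n^\top\in\mathbb{R}^{K\times Kn}$. Let $\sigma(\cdot)=\max(0,\cdot)$ be the element-wise ReLU, $\|\cdot\|_F$ the Frobenius norm and $\|\cdot\|_*$ the nuclear norm (the sum of the singular values). Let $(\mathbf{W}_2^*,\mathbf{W}_1^*,\mathbf{H}_1^*)\ne(\mathbf{0},\mathbf{0},\mathbf{0})$ be a global minimizer of $$\frac{1}{2Kn}\|\mathbf{W}_2\,\sigma(\mathbf{W}_1\mathbf{H}_1)-\mathbf{Y}\|_F^2+\frac{\lambda_{W_2}}{2}\|\mathbf{W}_2\|_F^2+\frac{\lambda_{W_1}}{2}\|\mathbf{W}_1\|_F^2+\frac{\lambda_{H_1}}{2}\|\mathbf{H}_1\|_F^2$$ over $\mathbf{W}_2\in\mathbb{R}^{K\times d}$, $\mathbf{W}_1\in\mathbb{R}^{d\times d}$, $\mathbf{H}_1\in\mathbb{R}^{d\times Kn}$. If $K\ge2$, assume that the regularization parameters do not lie on the critical surface $16K^3n\,\lambda_{W_2}\lambda_{W_1}\lambda_{H_1}=1$.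 Suppose that $\|\mathbf{W}_1^*\mathbf{H}_1^*\|_*=\|\sigma(\mathbf{W}_1^*\mathbf{H}_1^*)\|_*$. Then $\sigma(\mathbf{W}_1^*\mathbf{H}_1^*)$ collapses to an orthogonal $d\times K$ frame, and $\mathbf{W}_2^{*\top}$ is an orthogonal $d\times K$ matrix aligned with it. Precisely, $\sigma(\mathbf{W}_1^*\mathbf{H}_1^*)=\overline{\mathbf{H}}_2\otimes\mathbf{1}_n^\top$ for some entrywise non-negative $\overline{\mathbf{H}}_2\in\mathbb{R}^{d\times K}$ such that $\mathbf{W}_2^{*\top}\propto\overline{\mathbf{H}}_2$ and $$\mathbf{W}_2^*\overline{\mathbf{H}}_2\propto\overline{\mathbf{H}}_2^\top\overline{\mathbf{H}}_2\propto\mathbf{W}_2^*\mathbf{W}_2^{*\top}\propto\mathbf{I}_K,$$ where $\propto$ means equal up to a positive scalar factor. -/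

import Mathlib

open Matrix

namespace UFM

noncomputable section

/-- The squared Frobenius norm: the sum of the squares of all entries. -/
def frobSq {m n : Type*} [Fintype m] [Fintype n] (A : Matrix m n ℝ) : ℝ :=
  ∑ i, ∑ j, A i j ^ 2

/-- The nuclear norm: the sum of the singular values. A matrix with columns indexed by `n` has at
most `card n` nonzero singular values (those of the linear map between Euclidean spaces that it
defines). -/
def nuclearNorm {m n : Type*} [Fintype m] [Fintype n] [DecidableEq n] (A : Matrix m n ℝ) : ℝ :=
  ∑ i ∈ Finset.range (Fintype.card n), (Matrix.toEuclideanLin A).singularValues i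

/-- The ReLU function `max (0, ·)`, applied to every entry. -/
def relu {m n : Type*} (A : Matrix m n ℝ) : Matrix m n ℝ :=
  A.map (fun x => max 0 x)

/-- The matrix `A ⊗ 1ₙᵀ`: every column of `A` is repeated `n` times. The columns are indexed by
pairs (class, number of the sample in the class). -/
def repeatCols {m : Type*} {K : ℕ} (n : ℕ) (A : Matrix m (Fin K) ℝ) :
    Matrix m (Fin K × Fin n) ℝ :=
  Matrix.of fun r p => A r p.1

/-- The matrix `Y = I_K ⊗ 1ₙᵀ` of the one-hot label vectors. -/
def labels (K n : ℕ) : Matrix (Fin K) (Fin K × Fin n) ℝ :=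
  repeatCols n (1 : Matrix (Fin K) (Fin K) ℝ)

/-- The regularized mean squared error of the two-layer unconstrained features model with a ReLU
between the two layers of weights. -/
def objective (K n d : ℕ) (lamW₂ lamW₁ lamH₁ : ℝ) (W₂ : Matrix (Fin K) (Fin d) ℝ)
    (W₁ : Matrix (Fin d) (Fin d) ℝ) (H₁ : Matrix (Fin d) (Fin K × Fin n) ℝ) : ℝ :=
  1 / (2 * (K : ℝ) * (n : ℝ)) * frobSq (W₂ * relu (W₁ * H₁) - labels K n)
    + lamW₂ / 2 * frobSq W₂ + lamW₁ / 2 * frobSq W₁ + lamH₁ / 2 * frobSq H₁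

/-- `(W₂, W₁, H₁)` is a global minimizer of the objective. -/
def IsGlobalMinimizer (K n d : ℕ) (lamW₂ lamW₁ lamH₁ : ℝ) (W₂ : Matrix (Fin K) (Fin d) ℝ)
    (W₁ : Matrix (Fin d) (Fin d) ℝ) (H₁ : Matrix (Fin d) (Fin K × Fin n) ℝ) : Prop :=
  ∀ (V₂ : Matrix (Fin K) (Fin d) ℝ) (V₁ : Matrix (Fin d) (Fin d) ℝ)
    (G₁ : Matrix (Fin d) (Fin K × Fin n) ℝ),
    objective K n d lamW₂ lamW₁ lamH₁ W₂ W₁ H₁ ≤ objective K n d lamW₂ lamW₁ lamH₁ V₂ V₁ G₁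

/-- Two matrices are proportional: equal up to a positive scalar factor. -/
def Proportional {m n : Type*} (A B : Matrix m n ℝ) : Prop :=
  ∃ c : ℝ, 0 < c ∧ A = c • B

end

end UFM

/-! Write `A` for the rectified features, with singular values `a i`, and `Y` for the labels.
Equality of nuclear norms lets the penalties on `W₁` and `H₁` be bounded below by `√(lamW₁ * lamH₁)`
times the nuclear norm of `A` (`sqrt_mul_nuclearNorm_mul_le`). Ridge regression bounds the other two
terms (`ridge_lower_bound`). Both bounds split along the right singular vectors: direction `i`
carries a share in `[0, 1]` of the label energy, and the shares add up to `K`.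

Scaled orthogonal frames attain `K * directionCost … b` for every `b ≥ 0` (`exists_objective_eq`).
So at a minimizer, every positive `a i` has full share and every positive share sits at a minimizer
of `directionCost` (`weights_of_sum_le`). Off the critical surface a positive minimizer is the only
one (`directionCost_minimizers`); for `K = 1` one direction exhausts the total share. Hence `AᵀA` is
a multiple of `YᵀY`, which forces collapse and orthogonality, and strict convexity in `W₂` gives
alignment. -/

namespace UFM

/-! ### Frobenius norm. -/

variable {l m n : Type*} [Fintype l] [Fintype m] [Fintype n]

theorem frobSq_eq_trace (A : Matrix m n ℝ) : frobSq A = trace (A * Aᵀ) := by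
  simp [frobSq, trace, Matrix.mul_apply, sq]

theorem frobSq_transpose (A : Matrix m n ℝ) : frobSq Aᵀ = frobSq A := by
  unfold frobSq
  rw [Finset.sum_comm]
  rfl

theorem frobSq_nonneg (A : Matrix m n ℝ) : 0 ≤ frobSq A :=
  Finset.sum_nonneg fun _ _ => Finset.sum_nonneg fun _ _ => sq_nonneg _

theorem frobSq_smul (c : ℝ) (A : Matrix m n ℝ) : frobSq (c • A) = c ^ 2 * frobSq A := by
  simp [frobSq, mul_pow, Finset.mul_sum]

theorem eq_zero_of_frobSq_le_zero {A : Matrix m n ℝ} (h : frobSq A ≤ 0) : A = 0 := by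
  have h0 : frobSq A = 0 := le_antisymm h (frobSq_nonneg A)
  unfold frobSq at h0
  ext i j
  have h1 := (Finset.sum_eq_zero_iff_of_nonneg
    fun i _ => Finset.sum_nonneg fun j _ => sq_nonneg (A i j)).mp h0 i (Finset.mem_univ _)
  have h2 := (Finset.sum_eq_zero_iff_of_nonneg fun j _ => sq_nonneg (A i j)).mp h1 j
    (Finset.mem_univ _)
  simpa using h2

theorem frobSq_add (A B : Matrix m n ℝ) :
    frobSq (A + B) = frobSq A + 2 * trace (A * Bᵀ) + frobSq B := by
  have h : trace (B * Aᵀ) = trace (A * Bᵀ) := by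
    rw [← trace_transpose, transpose_mul, transpose_transpose]
  simp only [frobSq_eq_trace, transpose_add, Matrix.add_mul, Matrix.mul_add, trace_add, h]
  ring

theorem frobSq_mul_of_mul_transpose_eq_one [DecidableEq m] {U : Matrix m n ℝ}
    (hU : U * Uᵀ = 1) (A : Matrix l m ℝ) : frobSq (A * U) = frobSq A := by
  rw [frobSq_eq_trace, frobSq_eq_trace, transpose_mul, Matrix.mul_assoc, ← Matrix.mul_assoc U, hU,
    Matrix.one_mul]

/-- Multiplication by a partial isometry does not increase the Frobenius norm. -/
theorem frobSq_mul_le_of_partialIsometry {V : Matrix m n ℝ} (hV : V * Vᵀ * V = V)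
    (A : Matrix l m ℝ) : frobSq (A * V) ≤ frobSq A := by
  -- Pythagoras: `V * Vᵀ` is an orthogonal projection.
  have h : frobSq (A - A * V * Vᵀ) = frobSq A - frobSq (A * V) := by
    have h1 : A * V * Vᵀ * (V * (Vᵀ * Aᵀ)) = A * V * (Vᵀ * Aᵀ) := by
      calc A * V * Vᵀ * (V * (Vᵀ * Aᵀ)) = A * (V * Vᵀ * V) * (Vᵀ * Aᵀ) := by
            simp only [Matrix.mul_assoc]
        _ = _ := by rw [hV]
    simp only [frobSq_eq_trace, transpose_sub, transpose_mul, transpose_transpose, Matrix.sub_mul,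
      Matrix.mul_sub, h1, trace_sub]
    simp only [Matrix.mul_assoc]
    ring
  linarith [frobSq_nonneg (A - A * V * Vᵀ)]

/-! ### Singular values and the two lower bounds. -/

/-- The singular value decomposition of a real matrix: the columns of `U` are an orthonormal basis
of right singular vectors, and the columns of `V` are the left singular vectors of the nonzero
singular values, and zero otherwise. -/
theorem exists_singularValueDecomposition [DecidableEq n] (A : Matrix m n ℝ) :
    ∃ (U : Matrix n (Fin (Fintype.card n)) ℝ) (V : Matrix m (Fin (Fintype.card n)) ℝ)
      (a : Fin (Fintype.card n) → ℝ),
      U * Uᵀ = 1 ∧ Uᵀ * U = 1 ∧ V * Vᵀ * V = V ∧ (∀ i, 0 ≤ a i) ∧ A * U = V * diagonal a ∧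
        Vᵀ * A * U = diagonal a ∧ nuclearNorm A = ∑ i, a i := by
  classical
  set T := Matrix.toEuclideanLin A with hT
  have hn : Module.finrank ℝ (EuclideanSpace ℝ n) = Fintype.card n := finrank_euclideanSpace
  have hS := T.isSymmetric_adjoint_comp_self
  set b := hS.eigenvectorBasis hn with hb
  set a : Fin (Fintype.card n) → ℝ := fun i => T.singularValues i with ha
  set U : Matrix n (Fin (Fintype.card n)) ℝ := Matrix.of fun i j => b j i with hUdef
  have hU1 : Uᵀ * U = 1 := by
    ext i j
    have h := orthonormal_iff_ite.mp b.orthonormal i j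
    rw [Matrix.one_apply, ← h]
    simp [Matrix.mul_apply, hUdef, PiLp.inner_apply, mul_comm]
  have hU2 : U * Uᵀ = 1 :=
    (Matrix.mul_eq_one_comm_of_card_eq _ _ _ (Fintype.card_fin _)).mp hU1
  have hAU : Aᵀ * A * U = U * diagonal fun i => a i ^ 2 := by
    ext i j
    have h : Matrix.toEuclideanLin Aᴴ (Matrix.toEuclideanLin A (b j)) = a j ^ 2 • b j := by
      rw [Matrix.toEuclideanLin_conjTranspose_eq_adjoint, ha, T.sq_singularValues_fin hn]
      exact hS.apply_eigenvectorBasis hn j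
    have h' := congrArg (fun v : EuclideanSpace ℝ n => v i) h
    simp only [Matrix.ofLp_toLpLin, Matrix.toLin'_apply] at h'
    rw [Matrix.mulVec_mulVec] at h'
    rw [Matrix.mul_diagonal, mul_comm]
    simpa [Matrix.mul_apply, Matrix.mulVec, dotProduct, hUdef] using h'
  have hG : (A * U)ᵀ * (A * U) = diagonal fun i => a i ^ 2 := by
    calc (A * U)ᵀ * (A * U) = Uᵀ * (Aᵀ * A * U) := by
          simp only [transpose_mul, Matrix.mul_assoc]
      _ = _ := by rw [hAU, ← Matrix.mul_assoc, hU1, Matrix.one_mul]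
  have hcol : ∀ i j, a j = 0 → (A * U) i j = 0 := by
    intro i j hj
    have h := congrFun (congrFun hG j) j
    rw [diagonal_apply_eq, hj, Matrix.mul_apply] at h
    simp only [transpose_apply] at h
    rw [zero_pow two_ne_zero, Finset.sum_eq_zero_iff_of_nonneg fun _ _ => mul_self_nonneg _] at h
    simpa using h i (Finset.mem_univ _)
  -- As `0⁻¹ = 0`, the columns of `V` for zero singular values vanish, making `V` only a partial
  -- isometry.
  set V := A * U * diagonal (fun i => (a i)⁻¹) with hV
  have hVA : A * U = V * diagonal a := by
    rw [hV, Matrix.mul_assoc, diagonal_mul_diagonal]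
    ext i j
    rw [mul_diagonal]
    by_cases h : a j = 0
    · simp [h, hcol i j h]
    · simp [h]
  have hVtA : Vᵀ * (A * U) = diagonal a := by
    rw [hV, transpose_mul, diagonal_transpose, Matrix.mul_assoc, hG, diagonal_mul_diagonal]
    congr 1
    funext i
    by_cases h : a i = 0
    · simp [h]
    · field_simp
  refine ⟨U, V, a, hU2, hU1, ?_, fun i => T.singularValues_nonneg i, hVA, ?_, ?_⟩
  · conv_lhs => rw [Matrix.mul_assoc, hV, ← Matrix.mul_assoc Vᵀ, ← hV, hVtA]
    rw [diagonal_mul_diagonal]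
    ext i j
    rw [mul_diagonal]
    by_cases h : a j = 0
    · rw [hV, mul_diagonal]; simp [h]
    · simp [h]
  · rw [Matrix.mul_assoc, hVtA]
  · unfold nuclearNorm
    rw [Finset.sum_range]

/-- The nuclear norm is the inner product of `Wᵀ * V` and `H * U`, so weighted AM-GM applies
entrywise. -/
theorem sqrt_mul_nuclearNorm_mul_le [DecidableEq n] {x y : ℝ} (hx : 0 ≤ x) (hy : 0 ≤ y)
    (W : Matrix l m ℝ) (H : Matrix m n ℝ) :
    √(x * y) * nuclearNorm (W * H) ≤ x / 2 * frobSq W + y / 2 * frobSq H := by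
  obtain ⟨U, V, a, hU, -, hV, -, -, hVAU, hnn⟩ := exists_singularValueDecomposition (W * H)
  have h1 : frobSq (Wᵀ * V) ≤ frobSq W :=
    (frobSq_mul_le_of_partialIsometry hV _).trans_eq (frobSq_transpose W)
  have h2 : frobSq (H * U) = frobSq H := frobSq_mul_of_mul_transpose_eq_one hU H
  have h3 : ∑ i, a i = ∑ j, ∑ i, (Wᵀ * V) j i * (H * U) j i := by
    have h : (Wᵀ * V)ᵀ * (H * U) = diagonal a := by
      rw [← hVAU]; simp only [transpose_mul, transpose_transpose, Matrix.mul_assoc]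
    rw [Finset.sum_comm]
    refine Finset.sum_congr rfl fun i _ => ?_
    rw [← diagonal_apply_eq a i, ← h, Matrix.mul_apply]
    rfl
  have h4 : √(x * y) * nuclearNorm (W * H) ≤ x / 2 * frobSq (Wᵀ * V) + y / 2 * frobSq (H * U) := by
    rw [hnn, h3]
    unfold frobSq
    simp only [Finset.mul_sum, ← Finset.sum_add_distrib]
    refine Finset.sum_le_sum fun j _ => Finset.sum_le_sum fun i _ => ?_
    rw [Real.sqrt_mul hx]
    nlinarith [sq_nonneg (√x * (Wᵀ * V) j i - √y * (H * U) j i), Real.sq_sqrt hx, Real.sq_sqrt hy]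
  rw [h2] at h4
  nlinarith

/-- The value of ridge regression, bounded below through a singular value decomposition of the
matrix of features. -/
theorem ridge_lower_bound {k ι : Type*} [Fintype k] [Fintype ι] [DecidableEq n] [DecidableEq ι]
    {A : Matrix m n ℝ}
    {U : Matrix n ι ℝ} {V : Matrix m ι ℝ} {a : ι → ℝ} (hU : U * Uᵀ = 1) (hV : V * Vᵀ * V = V)
    (hA : A * U = V * diagonal a) (W : Matrix k m ℝ) (Y : Matrix k n ℝ) {N lam : ℝ} (hN : 0 < N)
    (hlam : 0 < lam) :
    ∑ i, lam / 2 * ((Y * U)ᵀ * (Y * U)) i i / (a i ^ 2 + N * lam)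
      ≤ 1 / (2 * N) * frobSq (W * A - Y) + lam / 2 * frobSq W := by
  have h1 : frobSq (W * A - Y) = frobSq (W * V * diagonal a - Y * U) := by
    rw [← frobSq_mul_of_mul_transpose_eq_one hU, Matrix.sub_mul, Matrix.mul_assoc W A, hA,
      Matrix.mul_assoc W V]
  have h2 := frobSq_mul_le_of_partialIsometry hV W
  have h3 : ∑ i, lam / 2 * ((Y * U)ᵀ * (Y * U)) i i / (a i ^ 2 + N * lam)
      ≤ 1 / (2 * N) * frobSq (W * V * diagonal a - Y * U) + lam / 2 * frobSq (W * V) := by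
    unfold frobSq
    simp only [Finset.mul_sum, ← Finset.sum_add_distrib]
    rw [Finset.sum_comm]
    refine Finset.sum_le_sum fun i _ => ?_
    rw [Matrix.mul_apply, Finset.mul_sum, Finset.sum_div]
    refine Finset.sum_le_sum fun j _ => ?_
    rw [Matrix.sub_apply, mul_diagonal, transpose_apply]
    generalize (W * V) j i = w
    generalize (Y * U) j i = y
    have hpos : 0 < a i ^ 2 + N * lam := by positivity
    -- Completing the square in `w`.
    have : 1 / (2 * N) * (w * a i - y) ^ 2 + lam / 2 * w ^ 2
        - lam / 2 * (y * y) / (a i ^ 2 + N * lam)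
        = ((a i ^ 2 + N * lam) * w - a i * y) ^ 2 / (2 * N * (a i ^ 2 + N * lam)) := by
      field_simp
      ring
    have : 0 ≤ ((a i ^ 2 + N * lam) * w - a i * y) ^ 2 / (2 * N * (a i ^ 2 + N * lam)) := by
      positivity
    linarith
  rw [h1]
  nlinarith

/-! ### The scalar problem for one singular direction. -/

section Scalar

variable {k c μ : ℝ}

/-- The cost `k / (2 (a² + c)) + μ a` of one direction with singular value `a`. -/
noncomputable def directionCost (k c μ a : ℝ) : ℝ := k / (2 * (a ^ 2 + c)) + μ * a

theorem mul_sq_eq_of_isMinOn (hc : 0 < c) {x : ℝ} (hx : 0 < x)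
    (hmin : ∀ b, 0 ≤ b → directionCost k c μ x ≤ directionCost k c μ b) :
    μ * (x ^ 2 + c) ^ 2 = k * x := by
  have hloc : IsLocalMin (directionCost k c μ) x := by
    filter_upwards [lt_mem_nhds hx] with b hb using hmin b hb.le
  have hne : 2 * (x ^ 2 + c) ≠ 0 := by positivity
  have hd : HasDerivAt (directionCost k c μ)
      ((0 * (2 * (x ^ 2 + c)) - k * (2 * (2 * x))) / (2 * (x ^ 2 + c)) ^ 2 + μ * 1) x := by
    refine ((hasDerivAt_const x k).div ?_ hne).add ((hasDerivAt_id x).const_mul μ)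
    refine HasDerivAt.const_mul 2 (HasDerivAt.add_const c ?_)
    simpa using hasDerivAt_pow 2 x
  have h0 := hloc.hasDerivAt_eq_zero hd
  have hne' : x ^ 2 + c ≠ 0 := by positivity
  field_simp at h0
  linarith

/-- Equality of the two minimal values, divided by `x - y`, gives `h1`. If both points are positive,
squaring `h1` and inserting both stationarity equations yields `(x + y)² = 4xy`. If `y = 0`,
stationarity at `x` leaves `x² = c`, hence the critical relation. -/
theorem directionCost_minimizers (hc : 0 < c) (hk : 0 < k) {x y : ℝ} (hx : 0 < x) (hy : 0 ≤ y)
    (hxm : ∀ b, 0 ≤ b → directionCost k c μ x ≤ directionCost k c μ b)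
    (hym : ∀ b, 0 ≤ b → directionCost k c μ y ≤ directionCost k c μ b) :
    x = y ∨ (y = 0 ∧ 16 * μ ^ 2 * c ^ 3 = k ^ 2) := by
  by_cases hxy : x = y
  · exact .inl hxy
  have hx' := mul_sq_eq_of_isMinOn hc hx hxm
  have heq : directionCost k c μ x = directionCost k c μ y := le_antisymm (hxm y hy) (hym x hx.le)
  have h1 : 2 * μ * ((x ^ 2 + c) * (y ^ 2 + c)) = k * (x + y) := by
    unfold directionCost at heq
    have hxc : x ^ 2 + c ≠ 0 := by positivity
    have hyc : y ^ 2 + c ≠ 0 := by positivity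
    field_simp at heq
    apply mul_left_cancel₀ (sub_ne_zero.mpr hxy)
    linear_combination heq
  rcases hy.eq_or_lt with rfl | hy
  · right
    have hxc : x ^ 2 + c ≠ 0 := by positivity
    have h2 : x ^ 2 = c := by
      have : μ * (x ^ 2 + c) * (x ^ 2 - c) = 0 := by linear_combination hx' - h1
      have hμ : μ ≠ 0 := by
        rintro rfl
        have : 0 < k * x := by positivity
        linarith
      have := (mul_eq_zero.mp this).resolve_left (mul_ne_zero hμ hxc)
      linarith
    refine ⟨rfl, ?_⟩
    rw [h2] at hx'
    have h3 : (4 * μ * c ^ 2) ^ 2 = (k * x) ^ 2 := by rw [← hx']; ring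
    rw [mul_pow k, h2] at h3
    apply mul_left_cancel₀ hc.ne'
    linear_combination h3
  · have hy' := mul_sq_eq_of_isMinOn hc hy hym
    have h2 : k ^ 2 * (x - y) ^ 2 = 0 := by
      have : (2 * μ * ((x ^ 2 + c) * (y ^ 2 + c))) ^ 2
        = 4 * (μ * (x ^ 2 + c) ^ 2) * (μ * (y ^ 2 + c) ^ 2) := by ring
      rw [h1, hx', hy'] at this
      linear_combination this
    have : x - y = 0 := by
      simpa [hk.ne'] using h2
    exact .inl (sub_eq_zero.mp this)

end Scalar

/-! ### Labels and ReLU. -/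

section Labels

variable {K n : ℕ}

theorem labels_apply (i : Fin K) (p : Fin K × Fin n) :
    labels K n i p = if i = p.1 then 1 else 0 := by
  simp [labels, repeatCols, Matrix.one_apply]

theorem labels_mul_transpose : labels K n * (labels K n)ᵀ = (n : ℝ) • 1 := by
  ext i j
  simp only [Matrix.mul_apply, transpose_apply, labels_apply, Fintype.sum_prod_type,
    Matrix.smul_apply, Matrix.one_apply]
  by_cases h : i = j
  · subst h; simp
  · simp [h]

theorem frobSq_labels : frobSq (labels K n) = K * n := by
  rw [frobSq_eq_trace, labels_mul_transpose]
  simp [mul_comm]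

theorem mul_labels {m : Type*} (B : Matrix m (Fin K) ℝ) : B * labels K n = repeatCols n B := by
  ext i p
  simp [Matrix.mul_apply, labels_apply, repeatCols]

theorem relu_nonneg {m ι : Type*} (A : Matrix m ι ℝ) (i j) : 0 ≤ relu A i j := le_max_left _ _

theorem relu_eq_self {m ι : Type*} {A : Matrix m ι ℝ} (hA : ∀ i j, 0 ≤ A i j) : relu A = A := by
  ext i j
  exact max_eq_right (hA i j)

end Labels

/-! ### Competitors attaining the lower bound. -/

section Competitor

/-- The `d × K` matrix whose columns are the first `K` standard basis vectors. -/
def stdFrame (d K : ℕ) : Matrix (Fin d) (Fin K) ℝ :=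
  Matrix.of fun i j => if (i : ℕ) = j then 1 else 0

theorem stdFrame_transpose_mul {d K : ℕ} (h : K ≤ d) : (stdFrame d K)ᵀ * stdFrame d K = 1 := by
  ext i j
  have : ∀ (k : Fin K) (x : Fin d), ((x : ℕ) = k) ↔ x = Fin.castLE h k :=
    fun k x => by simp [Fin.ext_iff]
  simp [Matrix.mul_apply, stdFrame, this, Matrix.one_apply, eq_comm]

theorem frobSq_eq_of_transpose_mul {m m' ι : Type*} [Fintype m] [Fintype m'] [Fintype ι]
    (E : Matrix m ι ℝ) (A : Matrix m' ι ℝ) (h : Eᵀ * E = Aᵀ * A) : frobSq E = frobSq A := by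
  rw [← frobSq_transpose, frobSq_eq_trace, transpose_transpose, h, ← frobSq_transpose A,
    frobSq_eq_trace, transpose_transpose]

/-- The objective takes the value `K * directionCost … b` for every `b ≥ 0`. -/
theorem exists_objective_eq {K n d : ℕ} (hK : 1 ≤ K) (hn : 1 ≤ n) (hd : K ≤ d)
    {lamW₂ lamW₁ lamH₁ : ℝ} (hW₂ : 0 < lamW₂) (hW₁ : 0 < lamW₁) (hH₁ : 0 < lamH₁)
    {b : ℝ} (hb : 0 ≤ b) :
    ∃ W₂ W₁ H₁, objective K n d lamW₂ lamW₁ lamH₁ W₂ W₁ H₁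
      = K * directionCost (n * lamW₂) (K * n * lamW₂) (√(lamW₁ * lamH₁)) b := by
  have hKpos : (0 : ℝ) < K := by exact_mod_cast hK
  have hnpos : (0 : ℝ) < n := by exact_mod_cast hn
  set E := stdFrame d K
  have hE : Eᵀ * E = 1 := stdFrame_transpose_mul hd
  set x := √lamW₁ with hx
  set y := √lamH₁ with hy
  have hxpos : 0 < x := Real.sqrt_pos.mpr hW₁
  have hypos : 0 < y := Real.sqrt_pos.mpr hH₁
  have hx2 : x ^ 2 = lamW₁ := Real.sq_sqrt hW₁.le
  have hy2 : y ^ 2 = lamH₁ := Real.sq_sqrt hH₁.le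
  set z := √(n : ℝ) with hz
  have hzpos : 0 < z := Real.sqrt_pos.mpr hnpos
  have hz2 : z ^ 2 = n := Real.sq_sqrt hnpos.le
  -- `α` and `β` balance the two penalties, `lamW₁ * α² = n * lamH₁ * β²`, and make the nonzero
  -- singular values of the features equal to `b = αβ√n`.
  set α := √(b * y / x) with hα
  set β := √(b * x / y) / z with hβ
  have hα2 : α ^ 2 = b * y / x := Real.sq_sqrt (by positivity)
  have hβ2 : β ^ 2 = b * x / y / n := by
    rw [hβ, div_pow, hz2, Real.sq_sqrt (by positivity)]
  have hα0 : 0 ≤ α := Real.sqrt_nonneg _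
  have hβ0 : 0 ≤ β := by positivity
  set r := α * β with hr
  have hr2 : r ^ 2 = b ^ 2 / n := by
    rw [hr, mul_pow, hα2, hβ2]; field_simp
  -- The ridge optimum for features `r • (E * labels K n)`.
  set t := r / (r ^ 2 + K * lamW₂) with ht
  have hZ : (α • (E * Eᵀ)) * (β • (E * labels K n)) = r • (E * labels K n) := by
    rw [Matrix.smul_mul, Matrix.mul_smul, smul_smul, Matrix.mul_assoc, ← Matrix.mul_assoc Eᵀ, hE,
      Matrix.one_mul]
  have hpos : ∀ i j, 0 ≤ (r • (E * labels K n)) i j := by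
    intro i j
    rw [mul_labels]
    simp only [Matrix.smul_apply, repeatCols, Matrix.of_apply, E, stdFrame, smul_eq_mul]
    split_ifs <;> simp [hr, mul_nonneg hα0 hβ0]
  refine ⟨t • Eᵀ, α • (E * Eᵀ), β • (E * labels K n), ?_⟩
  have h1 : (t • Eᵀ) * (r • (E * labels K n)) - labels K n = (t * r - 1) • labels K n := by
    rw [Matrix.smul_mul, Matrix.mul_smul, smul_smul, ← Matrix.mul_assoc, hE, Matrix.one_mul, sub_smul, one_smul]
  have hfE : frobSq Eᵀ = K := by
    rw [frobSq_eq_trace, transpose_transpose, hE]; simp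
  have hfEE : frobSq (E * Eᵀ) = K := by
    rw [frobSq_eq_of_transpose_mul (E * Eᵀ) Eᵀ, hfE]
    rw [transpose_mul, transpose_transpose, Matrix.mul_assoc, ← Matrix.mul_assoc Eᵀ, hE,
      Matrix.one_mul]
  have hfEY : frobSq (E * labels K n) = K * n := by
    rw [frobSq_eq_of_transpose_mul (E * labels K n) (labels K n), frobSq_labels]
    rw [transpose_mul, Matrix.mul_assoc, ← Matrix.mul_assoc Eᵀ, hE, Matrix.one_mul]
  unfold objective
  rw [hZ, relu_eq_self hpos, h1]
  simp only [frobSq_smul, hfE, hfEE, hfEY, frobSq_labels, hα2, hβ2, Real.sqrt_mul hW₁.le,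
    directionCost]
  have h2 : 1 / (2 * (K : ℝ) * n) * ((t * r - 1) ^ 2 * (K * n)) + lamW₂ / 2 * (t ^ 2 * K)
      = K * (n * lamW₂ / (2 * (b ^ 2 + K * n * lamW₂))) := by
    have hb2 : b ^ 2 = n * r ^ 2 := by rw [hr2]; field_simp
    have hD : r ^ 2 + K * lamW₂ ≠ 0 := by positivity
    rw [hb2, ht]
    have : (n : ℝ) * r ^ 2 + K * n * lamW₂ = n * (r ^ 2 + K * lamW₂) := by ring
    rw [this]
    field_simp
    ring
  rw [h2, ← hx2, ← hy2, Real.sqrt_sq hxpos.le, Real.sqrt_sq hypos.le]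
  field_simp
  ring

end Competitor

/-! ### Structure of a minimizer. -/

section Minimizer

variable {K n d : ℕ} {lamW₂ lamW₁ lamH₁ : ℝ} {W₂ : Matrix (Fin K) (Fin d) ℝ}
  {W₁ : Matrix (Fin d) (Fin d) ℝ} {H₁ : Matrix (Fin d) (Fin K × Fin n) ℝ}

theorem IsGlobalMinimizer.eq_zero_of_relu_eq_zero (hW₂ : 0 < lamW₂) (hW₁ : 0 < lamW₁)
    (hH₁ : 0 < lamH₁) (hmin : IsGlobalMinimizer K n d lamW₂ lamW₁ lamH₁ W₂ W₁ H₁)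
    (h : relu (W₁ * H₁) = 0) : (W₂, W₁, H₁) = (0, 0, 0) := by
  have h1 := hmin 0 0 0
  have h0 : frobSq (0 : Matrix (Fin K) (Fin d) ℝ) = 0 := by simp [frobSq]
  have h0' : frobSq (0 : Matrix (Fin d) (Fin d) ℝ) = 0 := by simp [frobSq]
  have h0'' : frobSq (0 : Matrix (Fin d) (Fin K × Fin n) ℝ) = 0 := by simp [frobSq]
  unfold objective at h1
  rw [h, Matrix.mul_zero, Matrix.zero_mul, h0, h0', h0''] at h1
  have p2 := mul_nonneg (half_pos hW₂).le (frobSq_nonneg W₂)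
  have p1 := mul_nonneg (half_pos hW₁).le (frobSq_nonneg W₁)
  have p0 := mul_nonneg (half_pos hH₁).le (frobSq_nonneg H₁)
  have aux : ∀ {c x : ℝ}, 0 < c → c * x ≤ 0 → x ≤ 0 := fun hc hx => by
    by_contra! hlt
    exact absurd (mul_pos hc hlt) (not_lt.mpr hx)
  rw [eq_zero_of_frobSq_le_zero (aux (half_pos hW₂) (by linarith : lamW₂ / 2 * frobSq W₂ ≤ 0)),
    eq_zero_of_frobSq_le_zero (aux (half_pos hW₁) (by linarith : lamW₁ / 2 * frobSq W₁ ≤ 0)),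
    eq_zero_of_frobSq_le_zero (aux (half_pos hH₁) (by linarith : lamH₁ / 2 * frobSq H₁ ≤ 0))]

theorem sum_sq_eq_of_mul_self {ι : Type*} [Fintype ι] {M : Matrix ι ι ℝ} {c : ℝ}
    (hsymm : Mᵀ = M) (hM : M * M = c • M) (i : ι) : ∑ j, M i j ^ 2 = c * M i i := by
  rw [← smul_eq_mul, ← Matrix.smul_apply, ← hM, Matrix.mul_apply]
  refine Finset.sum_congr rfl fun j _ => ?_
  rw [sq, ← transpose_apply M i j, hsymm]

/-- A symmetric matrix with `M² = c M` whose diagonal has entries `0` and `c` is diagonal. -/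
theorem eq_diagonal_of_mul_self {ι : Type*} [Fintype ι] [DecidableEq ι] {M : Matrix ι ι ℝ} {c : ℝ}
    (hsymm : Mᵀ = M) (hM : M * M = c • M) (hdiag : ∀ i, M i i = c ∨ M i i = 0) :
    M = diagonal fun i => M i i := by
  ext i j
  by_cases hij : i = j
  · subst hij; simp
  · rw [diagonal_apply_ne _ hij]
    -- The diagonal entry alone exhausts the sum of squares of its row.
    have h1 : M i i ^ 2 = c * M i i := by
      rcases hdiag i with h | h <;> rw [h] <;> ring
    have h2 := sum_sq_eq_of_mul_self hsymm hM i
    rw [← h1, ← Finset.add_sum_erase _ _ (Finset.mem_univ i), add_eq_left,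
      Finset.sum_eq_zero_iff_of_nonneg fun k _ => sq_nonneg (M i k)] at h2
    simpa using h2 j (Finset.mem_erase.mpr ⟨Ne.symm hij, Finset.mem_univ _⟩)

theorem apply_self_le_of_mul_self {ι : Type*} [Fintype ι] {M : Matrix ι ι ℝ} {c : ℝ}
    (hc : 0 ≤ c) (hsymm : Mᵀ = M) (hM : M * M = c • M) (i : ι) : M i i ≤ c := by
  have h := Finset.single_le_sum (fun j _ => sq_nonneg (M i j)) (Finset.mem_univ i)
  rw [sum_sq_eq_of_mul_self hsymm hM] at h
  by_contra! hlt
  nlinarith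

/-- If a weighted sum of costs does not exceed the cost of concentrating all the weight at any one
point, then the weights are `0` or `n`, and all those equal to `n` sit at a minimizer. -/
theorem weights_of_sum_le {ι : Type*} [Fintype ι] [Nonempty ι] {a p : ι → ℝ} {k c μ ν S : ℝ}
    (hν : 0 < ν) (hμ : 0 < μ) (hS : 0 < S)
    (ha : ∀ i, 0 ≤ a i) (hp0 : ∀ i, 0 ≤ p i) (hp : ∀ i, p i ≤ ν) (hsum : ∑ i, p i = S * ν)
    (h : ∀ b, 0 ≤ b → ∑ i, (k * (p i / ν) / (2 * (a i ^ 2 + c)) + μ * a i)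
      ≤ S * directionCost k c μ b) :
    (∀ i, 0 < a i → p i = ν) ∧
      ∀ i, 0 < p i → ∀ b, 0 ≤ b → directionCost k c μ (a i) ≤ directionCost k c μ b := by
  obtain ⟨j, hj⟩ := Finite.exists_min fun i => directionCost k c μ (a i)
  -- Each term is a weighted direction cost plus a nonnegative penalty for singular value carrying
  -- less than full weight.
  have hterm : ∀ i, k * (p i / ν) / (2 * (a i ^ 2 + c)) + μ * a i
      = p i / ν * directionCost k c μ (a i) + μ * (a i * (1 - p i / ν)) := fun i => by
    unfold directionCost; ring
  have hle1 : ∀ i, p i / ν ≤ 1 := fun i => (div_le_one hν).mpr (hp i)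
  have hge0 : ∀ i, 0 ≤ p i / ν := fun i => div_nonneg (hp0 i) hν.le
  have hsum' : ∑ i, p i / ν = S := by
    rw [← Finset.sum_div, hsum, mul_div_cancel_right₀ _ hν.ne']
  have hnn1 : ∀ i, 0 ≤ p i / ν * (directionCost k c μ (a i) - directionCost k c μ (a j)) :=
    fun i => mul_nonneg (hge0 i) (sub_nonneg.mpr (hj i))
  have hnn2 : ∀ i, 0 ≤ μ * (a i * (1 - p i / ν)) := fun i =>
    mul_nonneg hμ.le (mul_nonneg (ha i) (sub_nonneg.mpr (hle1 i)))
  have hdecomp : ∑ i, (k * (p i / ν) / (2 * (a i ^ 2 + c)) + μ * a i)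
      = S * directionCost k c μ (a j)
        + ∑ i, (p i / ν * (directionCost k c μ (a i) - directionCost k c μ (a j))
          + μ * (a i * (1 - p i / ν))) := by
    rw [← hsum', Finset.sum_mul, ← Finset.sum_add_distrib]
    refine Finset.sum_congr rfl fun i _ => ?_
    rw [hterm]
    ring
  have hnn : ∀ i ∈ Finset.univ,
      0 ≤ p i / ν * (directionCost k c μ (a i) - directionCost k c μ (a j))
        + μ * (a i * (1 - p i / ν)) := fun i _ => add_nonneg (hnn1 i) (hnn2 i)
  have hzero : ∑ i, (p i / ν * (directionCost k c μ (a i) - directionCost k c μ (a j))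
          + μ * (a i * (1 - p i / ν))) = 0 :=
    le_antisymm (by linarith [h (a j) (ha j)]) (Finset.sum_nonneg hnn)
  have hjmin : ∀ b, 0 ≤ b → directionCost k c μ (a j) ≤ directionCost k c μ b := by
    intro b hb
    have := h b hb
    rw [hdecomp, hzero, add_zero] at this
    exact le_of_mul_le_mul_left this hS
  have heach := (Finset.sum_eq_zero_iff_of_nonneg hnn).mp hzero
  refine ⟨fun i hi => ?_, fun i hi b hb => ?_⟩
  · have h2 : μ * (a i * (1 - p i / ν)) = 0 := by
      linarith [heach i (Finset.mem_univ _), hnn1 i, hnn2 i]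
    have h3 : 1 - p i / ν = 0 := by simpa [hμ.ne', hi.ne'] using h2
    exact (div_eq_one_iff_eq hν.ne').mp (by linarith)
  · have h1 : p i / ν * (directionCost k c μ (a i) - directionCost k c μ (a j)) = 0 := by
      linarith [heach i (Finset.mem_univ _), hnn1 i, hnn2 i]
    have h3 := (mul_eq_zero.mp h1).resolve_left (div_pos hi hν).ne'
    linarith [hjmin b hb]

/-- At a nonzero minimizer whose features have the same nuclear norm before and after the ReLU, the
Gram matrix of the features is a multiple of that of the labels. -/
theorem IsGlobalMinimizer.gram_relu (hK : 1 ≤ K) (hn : 1 ≤ n) (hd : K ≤ d)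
    (hW₂ : 0 < lamW₂) (hW₁ : 0 < lamW₁) (hH₁ : 0 < lamH₁)
    (hmin : IsGlobalMinimizer K n d lamW₂ lamW₁ lamH₁ W₂ W₁ H₁)
    (hne : (W₂, W₁, H₁) ≠ (0, 0, 0))
    (hcrit : 2 ≤ K → 16 * (K : ℝ) ^ 3 * (n : ℝ) * lamW₂ * lamW₁ * lamH₁ ≠ 1)
    (hnuc : nuclearNorm (W₁ * H₁) = nuclearNorm (relu (W₁ * H₁))) :
    ∃ ρ : ℝ, 0 < ρ ∧
      (relu (W₁ * H₁))ᵀ * relu (W₁ * H₁) = ρ • ((labels K n)ᵀ * labels K n) := by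
  have hKpos : (0 : ℝ) < K := by exact_mod_cast hK
  have hnpos : (0 : ℝ) < n := by exact_mod_cast hn
  have hfact := sqrt_mul_nuclearNorm_mul_le hW₁.le hH₁.le W₁ H₁
  rw [hnuc] at hfact
  set A := relu (W₁ * H₁) with hA
  set Y := labels K n with hY
  set μ := √(lamW₁ * lamH₁) with hμ
  have hμpos : 0 < μ := Real.sqrt_pos.mpr (mul_pos hW₁ hH₁)
  have hμ2 : μ ^ 2 = lamW₁ * lamH₁ := Real.sq_sqrt (mul_pos hW₁ hH₁).le
  obtain ⟨U, V, a, hU, -, hV, ha, hAU, hVAU, hnorm⟩ := exists_singularValueDecomposition A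
  have hridge := ridge_lower_bound hU hV hAU W₂ Y (mul_pos hKpos hnpos) hW₂
  set M := (Y * U)ᵀ * (Y * U) with hM
  have hMsymm : Mᵀ = M := by rw [hM, transpose_mul, transpose_transpose]
  -- `M / n` is an orthogonal projection, so its diagonal entries are shares in `[0, 1]`.
  have hMM : M * M = (n : ℝ) • M := by
    calc M * M = Uᵀ * Yᵀ * (Y * (U * Uᵀ) * Yᵀ) * (Y * U) := by
          simp only [hM, transpose_mul, Matrix.mul_assoc]
      _ = _ := by
        rw [hU, Matrix.mul_one, hY, labels_mul_transpose, Matrix.mul_smul, Matrix.mul_one,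
          Matrix.smul_mul, hM, transpose_mul]
  have hp : ∀ i, M i i ≤ n := apply_self_le_of_mul_self hnpos.le hMsymm hMM
  have hp0 : ∀ i, 0 ≤ M i i := fun i => by
    rw [hM, Matrix.mul_apply]
    exact Finset.sum_nonneg fun j _ => mul_self_nonneg _
  have hsum : ∑ i, M i i = K * n := by
    rw [← frobSq_labels, ← frobSq_mul_of_mul_transpose_eq_one hU, ← frobSq_transpose,
      frobSq_eq_trace, transpose_transpose]
    rfl
  have hbound : ∀ b, 0 ≤ b → ∑ i, (n * lamW₂ * (M i i / n) / (2 * (a i ^ 2 + K * n * lamW₂))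
      + μ * a i) ≤ K * directionCost (n * lamW₂) (K * n * lamW₂) μ b := by
    intro b hb
    obtain ⟨V₂, V₁, G₁, hV⟩ := exists_objective_eq hK hn hd hW₂ hW₁ hH₁ hb
    rw [← hV]
    refine le_trans ?_ (hmin V₂ V₁ G₁)
    unfold objective
    rw [← hA, ← hY, Finset.sum_add_distrib, ← Finset.mul_sum, ← hnorm, mul_assoc 2]
    have : ∀ i, (n : ℝ) * lamW₂ * (M i i / n) / (2 * (a i ^ 2 + K * n * lamW₂))
        = lamW₂ / 2 * M i i / (a i ^ 2 + K * n * lamW₂) := fun i => by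
      field_simp
    rw [Finset.sum_congr rfl fun i _ => this i]
    linarith
  have : Nonempty (Fin (Fintype.card (Fin K × Fin n))) :=
    ⟨⟨0, Fintype.card_pos_iff.mpr ⟨(⟨0, hK⟩, ⟨0, hn⟩)⟩⟩⟩
  obtain ⟨hw1, hw2⟩ := weights_of_sum_le hnpos hμpos hKpos ha hp0 hp hsum hbound
  by_cases hzero : ∀ i, a i = 0
  · exfalso
    apply hne
    apply hmin.eq_zero_of_relu_eq_zero hW₂ hW₁ hH₁
    have ha0 : a = 0 := funext hzero
    rw [← hA, ← Matrix.mul_one A, ← hU, ← Matrix.mul_assoc, hAU, ha0]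
    simp
  push Not at hzero
  obtain ⟨i₀, hi₀⟩ := hzero
  have hs : 0 < a i₀ := lt_of_le_of_ne (ha i₀) (Ne.symm hi₀)
  have hpi₀ := hw1 i₀ hs
  have hsmin := hw2 i₀ (hpi₀ ▸ hnpos)
  set s := a i₀ with hsdef
  have hkpos : 0 < n * lamW₂ := mul_pos hnpos hW₂
  have hcpos : 0 < K * n * lamW₂ := by positivity
  have hdich : ∀ i, (M i i = n ∧ a i = s) ∨ (M i i = 0 ∧ a i = 0) := by
    intro i
    rcases (ha i).eq_or_lt with hai | hai
    · right
      refine ⟨?_, hai.symm⟩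
      by_contra hMi
      have hMpos : 0 < M i i := lt_of_le_of_ne (hp0 i) (Ne.symm hMi)
      rcases directionCost_minimizers hcpos hkpos hs (ha i) hsmin (hw2 i hMpos) with h | ⟨-, h⟩
      · exact hs.ne' (h.trans hai.symm)
      · rw [hμ2] at h
        have hcr : 16 * (K : ℝ) ^ 3 * (n : ℝ) * lamW₂ * lamW₁ * lamH₁ = 1 := by
          -- The scalar critical relation is the critical surface equation times `(n * lamW₂)²`.
          apply mul_left_cancel₀ (pow_ne_zero 2 hkpos.ne')
          linear_combination h
        have hK1 : K = 1 := by
          by_contra hK1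
          exact hcrit (by omega) hcr
        have hii : i₀ ≠ i := by
          rintro rfl
          exact hs.ne hai
        -- With `K = 1` the total weight is `n`, already used up by `i₀`.
        have h2 := Finset.add_le_sum (fun j _ => hp0 j) (Finset.mem_univ i₀) (Finset.mem_univ i) hii
        rw [hsum, hK1, hpi₀] at h2
        simp only [Nat.cast_one, one_mul] at h2
        linarith
    · left
      have hMi := hw1 i hai
      rcases directionCost_minimizers hcpos hkpos hs (ha i) hsmin (hw2 i (hMi ▸ hnpos)) with h | h
      · exact ⟨hMi, h.symm⟩
      · exact absurd h.1 hai.ne'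
  have hMdiag := eq_diagonal_of_mul_self hMsymm hMM fun i => (hdich i).imp And.left And.left
  -- Both sides are diagonal: `a i ^ 2` is `s ^ 2` where `M i i = n` and zero elsewhere.
  have hgram : (A * U)ᵀ * (A * U) = (s ^ 2 / n) • M := by
    have hVV : Vᵀ * V * diagonal a = diagonal a := by
      rw [Matrix.mul_assoc, ← hAU, ← Matrix.mul_assoc, hVAU]
    rw [hMdiag, hAU, transpose_mul, diagonal_transpose, Matrix.mul_assoc, ← Matrix.mul_assoc Vᵀ,
      hVV, diagonal_mul_diagonal]
    ext i j
    by_cases hij : i = j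
    · subst hij
      rw [Matrix.smul_apply, diagonal_apply_eq, diagonal_apply_eq, smul_eq_mul]
      rcases hdich i with ⟨h1, h2⟩ | ⟨h1, h2⟩
      · rw [h1, h2]; field_simp
      · rw [h1, h2]; simp
    · rw [Matrix.smul_apply, diagonal_apply_ne _ hij, diagonal_apply_ne _ hij, smul_zero]
  have hconj : ∀ {k : ℕ} (B : Matrix (Fin k) (Fin K × Fin n) ℝ),
      Bᵀ * B = U * ((B * U)ᵀ * (B * U)) * Uᵀ := fun B => by
    calc Bᵀ * B = (U * Uᵀ) * (Bᵀ * B) * (U * Uᵀ) := by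
          rw [hU, Matrix.one_mul, Matrix.mul_one]
      _ = _ := by simp only [transpose_mul, Matrix.mul_assoc]
  refine ⟨s ^ 2 / n, by positivity, ?_⟩
  rw [hconj A, hconj Y, hgram, hM, Matrix.mul_smul, Matrix.smul_mul]

/-! ### From the Gram matrix to collapse and alignment. -/

/-- Two columns of one class have squared norms and inner product all equal to `ρ`, so their squared
distance is `ρ - 2ρ + ρ = 0`. -/
theorem eq_repeatCols_of_gram {m : Type*} [Fintype m] {A : Matrix m (Fin K × Fin n) ℝ} {ρ : ℝ}
    (hn : 0 < n) (h : Aᵀ * A = ρ • ((labels K n)ᵀ * labels K n)) :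
    A = repeatCols n (Matrix.of fun r k => A r (k, ⟨0, hn⟩)) ∧
      (Matrix.of fun r k => A r (k, ⟨0, hn⟩))ᵀ * (Matrix.of fun r k => A r (k, ⟨0, hn⟩))
        = ρ • (1 : Matrix (Fin K) (Fin K) ℝ) := by
  have hentry : ∀ p q : Fin K × Fin n, ∑ r, A r p * A r q = if p.1 = q.1 then ρ else 0 := by
    intro p q
    have h1 := congrFun (congrFun h p) q
    rw [Matrix.mul_apply] at h1
    simp only [transpose_apply] at h1
    rw [h1]
    simp [Matrix.mul_apply, labels_apply, eq_comm]
  constructor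
  · ext r ⟨k, i⟩
    have h0 : ∑ r, (A r (k, i) - A r (k, ⟨0, hn⟩)) ^ 2 = 0 := by
      have : ∀ r, (A r (k, i) - A r (k, ⟨0, hn⟩)) ^ 2 = A r (k, i) * A r (k, i)
          - 2 * (A r (k, i) * A r (k, ⟨0, hn⟩)) + A r (k, ⟨0, hn⟩) * A r (k, ⟨0, hn⟩) :=
        fun r => by ring
      simp only [this, Finset.sum_add_distrib, Finset.sum_sub_distrib, ← Finset.mul_sum, hentry]
      simp
      ring
    have h1 := (Finset.sum_eq_zero_iff_of_nonneg fun r _ => sq_nonneg _).mp h0 r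
      (Finset.mem_univ _)
    simpa [repeatCols, sub_eq_zero] using h1
  · ext k k'
    rw [Matrix.mul_apply]
    simp only [transpose_apply, of_apply, hentry]
    simp [Matrix.one_apply]

/-- For collapsed orthogonal features, the optimal last layer is a multiple of their transpose. -/
theorem IsGlobalMinimizer.eq_smul_transpose (hK : 1 ≤ K) (hn : 1 ≤ n) (hW₂ : 0 < lamW₂)
    (hmin : IsGlobalMinimizer K n d lamW₂ lamW₁ lamH₁ W₂ W₁ H₁)
    {B : Matrix (Fin d) (Fin K) ℝ} {ρ : ℝ} (hρ : 0 < ρ) (hA : relu (W₁ * H₁) = repeatCols n B)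
    (hB : Bᵀ * B = ρ • (1 : Matrix (Fin K) (Fin K) ℝ)) :
    W₂ = (1 / (ρ + K * lamW₂)) • Bᵀ := by
  have hKpos : (0 : ℝ) < K := by exact_mod_cast hK
  have hnpos : (0 : ℝ) < n := by exact_mod_cast hn
  set t := 1 / (ρ + K * lamW₂) with ht
  have htpos : 0 < ρ + K * lamW₂ := by positivity
  set D := W₂ - t • Bᵀ with hD
  have hW : W₂ = t • Bᵀ + D := by rw [hD]; abel
  have h := hmin (t • Bᵀ) W₁ H₁
  unfold objective at h
  have h1 : (t • Bᵀ) * (B * labels K n) = (t * ρ) • labels K n := by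
    rw [Matrix.smul_mul, ← Matrix.mul_assoc, hB, Matrix.smul_mul, smul_smul, Matrix.one_mul]
  have h2 : W₂ * (B * labels K n) - labels K n
      = (t * ρ - 1) • labels K n + D * (B * labels K n) := by
    rw [hW, Matrix.add_mul, h1, sub_smul, one_smul]; abel
  have h3 : (t • Bᵀ) * (B * labels K n) - labels K n = (t * ρ - 1) • labels K n := by
    rw [h1, sub_smul, one_smul]
  have h4 : trace ((t * ρ - 1) • labels K n * (D * (B * labels K n))ᵀ)
      = (t * ρ - 1) * n * trace (Bᵀ * Dᵀ) := by
    rw [transpose_mul, transpose_mul, Matrix.smul_mul, ← Matrix.mul_assoc, ← Matrix.mul_assoc,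
      labels_mul_transpose, Matrix.smul_mul, Matrix.one_mul, Matrix.smul_mul, trace_smul,
      trace_smul, smul_eq_mul, smul_eq_mul, mul_assoc]
  have h5 : trace (t • Bᵀ * Dᵀ) = t * trace (Bᵀ * Dᵀ) := by
    rw [Matrix.smul_mul, trace_smul, smul_eq_mul]
  rw [hA, ← mul_labels, h3, h2, frobSq_add _ (D * _), h4, hW, frobSq_add _ D, h5] at h
  -- This choice of `t` cancels the terms linear in `D`, leaving only nonnegative quadratic ones.
  have h6 : 1 / (2 * (K : ℝ) * n) * (2 * ((t * ρ - 1) * n * trace (Bᵀ * Dᵀ)))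
      + lamW₂ / 2 * (2 * (t * trace (Bᵀ * Dᵀ))) = 0 := by
    rw [ht]; field_simp; ring
  have h7 : 0 ≤ 1 / (2 * (K : ℝ) * n) * frobSq (D * (B * labels K n)) :=
    mul_nonneg (by positivity) (frobSq_nonneg _)
  have h8 : lamW₂ / 2 * frobSq D ≤ 0 := by linarith
  have h9 : D = 0 := by
    apply eq_zero_of_frobSq_le_zero
    by_contra! hlt
    exact absurd (mul_pos (half_pos hW₂) hlt) (not_lt.mpr h8)
  rw [hW, h9, add_zero]

end Minimizer

end UFM

theorem theorem4 (K n d : ℕ) (hK : 1 ≤ K) (hn : 1 ≤ n) (hd : K < d)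
    (lamW₂ lamW₁ lamH₁ : ℝ) (hW₂ : 0 < lamW₂) (hW₁ : 0 < lamW₁) (hH₁ : 0 < lamH₁)
    (W₂ : Matrix (Fin K) (Fin d) ℝ) (W₁ : Matrix (Fin d) (Fin d) ℝ)
    (H₁ : Matrix (Fin d) (Fin K × Fin n) ℝ)
    (hmin : UFM.IsGlobalMinimizer K n d lamW₂ lamW₁ lamH₁ W₂ W₁ H₁)
    (hne : (W₂, W₁, H₁) ≠ (0, 0, 0))
    (hcrit : 2 ≤ K → 16 * (K : ℝ) ^ 3 * (n : ℝ) * lamW₂ * lamW₁ * lamH₁ ≠ 1)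
    (hnuc : UFM.nuclearNorm (W₁ * H₁) = UFM.nuclearNorm (UFM.relu (W₁ * H₁))) :
    ∃ Hbar₂ : Matrix (Fin d) (Fin K) ℝ,
      (∀ i k, 0 ≤ Hbar₂ i k) ∧
      UFM.relu (W₁ * H₁) = UFM.repeatCols n Hbar₂ ∧
      UFM.Proportional (Matrix.transpose W₂) Hbar₂ ∧
      UFM.Proportional (W₂ * Hbar₂) (Matrix.transpose Hbar₂ * Hbar₂) ∧
      UFM.Proportional (Matrix.transpose Hbar₂ * Hbar₂) (W₂ * Matrix.transpose W₂) ∧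
      UFM.Proportional (W₂ * Matrix.transpose W₂) (1 : Matrix (Fin K) (Fin K) ℝ) := by
  obtain ⟨ρ, hρ, hgram⟩ := hmin.gram_relu hK hn hd.le hW₂ hW₁ hH₁ hne hcrit hnuc
  obtain ⟨hrep, hB⟩ := UFM.eq_repeatCols_of_gram hn hgram
  set B : Matrix (Fin d) (Fin K) ℝ := Matrix.of fun r k => UFM.relu (W₁ * H₁) r (k, ⟨0, hn⟩)
  have hW := hmin.eq_smul_transpose hK hn hW₂ hρ hrep hB
  have ht : 0 < 1 / (ρ + K * lamW₂) := by positivity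
  set t := 1 / (ρ + K * lamW₂)
  have hWW : W₂ * W₂ᵀ = t ^ 2 • (Bᵀ * B) := by
    rw [hW, transpose_smul, transpose_transpose, Matrix.smul_mul, Matrix.mul_smul, smul_smul, sq]
  refine ⟨B, fun i k => UFM.relu_nonneg _ _ _, hrep, ⟨t, ht, ?_⟩, ⟨t, ht, ?_⟩,
    ⟨(t ^ 2)⁻¹, by positivity, ?_⟩, ⟨t ^ 2 * ρ, by positivity, ?_⟩⟩
  · rw [hW, transpose_smul, transpose_transpose]
  · rw [hW, Matrix.smul_mul]
  · rw [hWW, smul_smul, inv_mul_cancel₀ (by positivity), one_smul]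
  · rw [hWW, hB, smul_smul]
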